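/- Let $G$ be a set and let $c : G\times G\to[0,\infty)$ satisfy $c_{xy}=c_{yx}$ and $c_{xx}=0$; write $x\sim y$ if $c_{xy}>0$. Assume that the resulting graph is connected and that every vertex has only finitely many neighbours, and fix a vertex $o\in G$. For $u:G\to\mathbb{R}$ put $(\Delta u)(x)=\sum_{y\sim x}c_{xy}(u(x)-u(y))$, and for $u,v:G\to\mathbb R$ of finite energy put $$\mathcal{E}(u,v)=\tfrac12\sum_{x,y\in G}c_{xy}(u(x)-u(y))(v(x)-v(y)),\qquad \operatorname{dom}\mathcal{E}=\{u:G\to\mathbb{R} : \mathcal{E}(u,u)<\infty\}.$$ Let $\mathcal{H}_{\mathcal E}=\operatorname{dom}\mathcal{E}/\mathbb{R}\mathbf{1}$, with inner product $\langle u,v\rangle_{\mathcal E}=\mathcal{E}(u,v)$, and let $\ell^2(G)$ be the space of square-summable real functions on $G$ with respect to counting measure. Let $\delta_x$ be the characteristic function of $\{x\}$, regarded as an element of $\ell^2(G)$ and also of $\mathcal{H}_{\mathcal E}$. For $x\in G$ let $v_x\in\mathcal{H}_{\mathcal E}$ be the element with $\langle v_x,u\rangle_{\mathcal E}=u(x)-u(o)$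 for all $u\in\mathcal{H}_{\mathcal E}$. If there is a $w\in\mathcal{H}_{\mathcal E}$ with $\Delta w=\delta_o$ pointwise, let $w_o$ be the one of minimal energy and put $w_x=w_o+v_x$ for $x\ne o$. Define the following operators. * $\Delta_{\ell^2}$ is the closure in $\ell^2(G)$ of $\Delta$ with domain $\operatorname{span}\{\delta_x\}_{x\in G}$. * $\Delta_{\mathcal{H}_{\mathcal E}}$ is the closure in $\mathcal{H}_{\mathcal E}$ of $\Delta$ with domain $\operatorname{span}\{w_x\}_{x\in G}$ if $w_o$ exists, and with domain $\operatorname{span}\{v_x\}_{x\in G}$ otherwise. * $J:\ell^2(G)\to\mathcal{H}_{\mathcal E}$ is the closure of the linear operator with domain $\operatorname{span}\{\delta_x\}_{x\in G}$ and $\delta_x\mapsto\delta_x$. An operator $T$ is called bounded if there is a constant $C$ with $\|Tu\|\le C\|u\|$ for all $u\in\operatorname{dom}T$, and $\|T\|$ is then the least such $C\ge 0$. The following are equivalent: 1. $\Delta_{\ell^2}$ is bounded on $\ell^2(G)$; 2. $\Delta_{\mathcal{H}_{\mathcal E}}$ is bounded on $\mathcal{H}_{\mathcal E}$; 3. $J:\ell^2(G)\to\mathcal{H}_{\mathcal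 E}$ is bounded. In this case $\|\Delta_{\ell^2}\|=\|\Delta_{\mathcal{H}_{\mathcal E}}\|=\|J\|^2$. -/

import Mathlib

noncomputable section

open scoped Classical in
/-- The point mass at `x`, as a function on `G`. -/
def dirac {G : Type*} (x : G) : G → ℝ := Pi.single x 1

/-- A linear operator `T`, defined on a linear subspace `T.domain`, is bounded if
`‖T x‖ ≤ C ‖x‖` on its domain, for some constant `C`. -/
def LinearPMap.IsBoundedOp {E F : Type*} [NormedAddCommGroup E] [NormedSpace ℝ E]
    [NormedAddCommGroup F] [NormedSpace ℝ F] (T : E →ₗ.[ℝ] F) : Prop :=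
  ∃ C : ℝ, ∀ x : T.domain, ‖T x‖ ≤ C * ‖(x : E)‖

/-- The operator norm of an operator defined on a linear subspace: the least bound `C ≥ 0`
(meaningful for bounded operators). -/
def LinearPMap.operatorNorm {E F : Type*} [NormedAddCommGroup E] [NormedSpace ℝ E]
    [NormedAddCommGroup F] [NormedSpace ℝ F] (T : E →ₗ.[ℝ] F) : ℝ :=
  sInf {C : ℝ | 0 ≤ C ∧ ∀ x : T.domain, ‖T x‖ ≤ C * ‖(x : E)‖}

/-- A (resistance) network: a connected, locally finite, weighted undirected graph without loops,
given by its conductance function; `x` and `y` are adjacent iff `0 < c x y`. -/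
structure ResistanceNetwork (G : Type*) where
  c : G → G → ℝ
  c_nonneg : ∀ x y, 0 ≤ c x y
  c_symm : ∀ x y, c x y = c y x
  c_self : ∀ x, c x x = 0
  locallyFinite : ∀ x, {y | 0 < c x y}.Finite
  connected : ∀ x y, Relation.ReflTransGen (fun a b => 0 < c a b) x y

namespace ResistanceNetwork

variable {G : Type*} (N : ResistanceNetwork G)

/-- The finite set of neighbours of `x`. -/
def nbrs (x : G) : Finset G := (N.locallyFinite x).toFinset

/-- The Laplacian `(Δu)(x) = ∑_{y ∼ x} c_{xy} (u(x) - u(y))`, on all functions. -/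
def lap : (G → ℝ) →ₗ[ℝ] (G → ℝ) where
  toFun u x := ∑ y ∈ N.nbrs x, N.c x y * (u x - u y)
  map_add' u v := by
    ext x
    simp only [Pi.add_apply, ← Finset.sum_add_distrib]
    exact Finset.sum_congr rfl fun y _ => by ring
  map_smul' a u := by
    ext x
    simp only [Pi.smul_apply, smul_eq_mul, RingHom.id_apply, Finset.mul_sum]
    exact Finset.sum_congr rfl fun y _ => by ring

/-- The term of the energy form at a pair of vertices. -/
def energyTerm (u v : G → ℝ) (p : G × G) : ℝ :=
  N.c p.1 p.2 * (u p.1 - u p.2) * (v p.1 - v p.2)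

/-- The energy form `½ ∑_{x,y} c_{xy} (u(x) - u(y)) (v(x) - v(y))`. -/
def energy (u v : G → ℝ) : ℝ := (1 / 2) * ∑' p : G × G, N.energyTerm u v p

lemma energyTerm_self_nonneg (u : G → ℝ) (p : G × G) : 0 ≤ N.energyTerm u u p := by
  unfold energyTerm
  rw [mul_assoc]
  exact mul_nonneg (N.c_nonneg _ _) (mul_self_nonneg _)

/-- The sum of the energy form converges absolutely for functions of finite energy. -/
lemma summable_energyTerm {u v : G → ℝ} (hu : Summable (N.energyTerm u u))
    (hv : Summable (N.energyTerm v v)) : Summable (N.energyTerm u v) := by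
  refine Summable.of_norm_bounded (hu.add hv) fun p => ?_
  have hc := N.c_nonneg p.1 p.2
  rw [Real.norm_eq_abs, abs_le]
  unfold energyTerm
  constructor
  · nlinarith [mul_nonneg hc (sq_nonneg ((u p.1 - u p.2) + (v p.1 - v p.2))),
      mul_nonneg hc (sq_nonneg (u p.1 - u p.2)), mul_nonneg hc (sq_nonneg (v p.1 - v p.2))]
  · nlinarith [mul_nonneg hc (sq_nonneg ((u p.1 - u p.2) - (v p.1 - v p.2))),
      mul_nonneg hc (sq_nonneg (u p.1 - u p.2)), mul_nonneg hc (sq_nonneg (v p.1 - v p.2))]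

/-- The space `dom 𝓔` of functions of finite energy. -/
def domEnergy : Submodule ℝ (G → ℝ) where
  carrier := {u | Summable (N.energyTerm u u)}
  zero_mem' := by
    have : N.energyTerm (0 : G → ℝ) 0 = 0 := by ext p; simp [energyTerm]
    simp only [Set.mem_ofPred_eq, this]
    exact summable_zero
  add_mem' {u v} hu hv := by
    have huv := N.summable_energyTerm hu hv
    have : N.energyTerm (u + v) (u + v) = fun p =>
        N.energyTerm u u p + 2 * N.energyTerm u v p + N.energyTerm v v p := by
      ext p; simp only [energyTerm, Pi.add_apply]; ring
    simp only [Set.mem_ofPred_eq, this]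
    exact (hu.add (huv.mul_left 2)).add hv
  smul_mem' a u hu := by
    have : N.energyTerm (a • u) (a • u) = fun p => a ^ 2 * N.energyTerm u u p := by
      ext p; simp only [energyTerm, Pi.smul_apply, smul_eq_mul]; ring
    simp only [Set.mem_ofPred_eq, this]
    exact hu.mul_left _

/-- The energy form as a bilinear form on `dom 𝓔`. -/
def energyForm : N.domEnergy →ₗ[ℝ] N.domEnergy →ₗ[ℝ] ℝ :=
  LinearMap.mk₂ ℝ (fun u v => N.energy u v)
    (fun u u' v => by
      have h1 := N.summable_energyTerm u.2 v.2
      have h2 := N.summable_energyTerm u'.2 v.2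
      unfold energy
      rw [← mul_add, ← h1.tsum_add h2]
      refine congrArg (fun t : ℝ => 1 / 2 * t) (tsum_congr fun p => ?_)
      simp only [energyTerm, Submodule.coe_add, Pi.add_apply]; ring)
    (fun a u v => by
      unfold energy
      rw [smul_eq_mul, mul_left_comm, ← tsum_mul_left (a := a)]
      refine congrArg (fun t : ℝ => 1 / 2 * t) (tsum_congr fun p => ?_)
      simp only [energyTerm, Submodule.coe_smul, Pi.smul_apply, smul_eq_mul]; ring)
    (fun u v v' => by
      have h1 := N.summable_energyTerm u.2 v.2
      have h2 := N.summable_energyTerm u.2 v'.2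
      unfold energy
      rw [← mul_add, ← h1.tsum_add h2]
      refine congrArg (fun t : ℝ => 1 / 2 * t) (tsum_congr fun p => ?_)
      simp only [energyTerm, Submodule.coe_add, Pi.add_apply]; ring)
    (fun a u v => by
      unfold energy
      rw [smul_eq_mul, mul_left_comm, ← tsum_mul_left (a := a)]
      refine congrArg (fun t : ℝ => 1 / 2 * t) (tsum_congr fun p => ?_)
      simp only [energyTerm, Submodule.coe_smul, Pi.smul_apply, smul_eq_mul]; ring)

/-- The constant functions, as a subspace of `dom 𝓔`. -/
def constants : Submodule ℝ N.domEnergy :=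
  (Submodule.span ℝ {(1 : G → ℝ)}).comap N.domEnergy.subtype

lemma mem_constants {u : N.domEnergy} :
    u ∈ N.constants ↔ ∃ k : ℝ, ∀ x, (u : G → ℝ) x = k := by
  simp only [constants, Submodule.mem_comap, Submodule.subtype_apply, Submodule.mem_span_singleton]
  refine exists_congr fun k => ?_
  rw [funext_iff]
  simp [eq_comm]

/-- The energy space `H_𝓔 = dom 𝓔 / ℝ1`. -/
def EnergySpace : Type _ := N.domEnergy ⧸ N.constants

instance : AddCommGroup N.EnergySpace :=
  inferInstanceAs (AddCommGroup (N.domEnergy ⧸ N.constants))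

instance : Module ℝ N.EnergySpace :=
  inferInstanceAs (Module ℝ (N.domEnergy ⧸ N.constants))

/-- The class in `H_𝓔` of a function of finite energy. -/
def toEnergySpace : N.domEnergy →ₗ[ℝ] N.EnergySpace := N.constants.mkQ

lemma toEnergySpace_surjective : Function.Surjective N.toEnergySpace :=
  N.constants.mkQ_surjective

lemma energyForm_symm (u v : N.domEnergy) : N.energyForm u v = N.energyForm v u := by
  change N.energy u v = N.energy v u
  unfold energy
  congr 2; ext p; simp only [energyTerm]; ring

lemma energyForm_const {u : N.domEnergy} (hu : u ∈ N.constants) (v : N.domEnergy) :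
    N.energyForm u v = 0 := by
  obtain ⟨k, hk⟩ := N.mem_constants.1 hu
  change N.energy u v = 0
  simp [energy, energyTerm, hk]

lemma energyForm_nonneg (u : N.domEnergy) : 0 ≤ N.energyForm u u :=
  mul_nonneg (by norm_num) (tsum_nonneg (N.energyTerm_self_nonneg _))

/-- The kernel of the energy form consists of the constants (by connectedness). -/
lemma mem_constants_of_energyForm_eq_zero {u : N.domEnergy} (hu : N.energyForm u u = 0) :
    u ∈ N.constants := by
  have h0 : ∑' p, N.energyTerm (u : G → ℝ) u p = 0 := by
    change (1 / 2 : ℝ) * _ = 0 at hu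
    linarith
  have h1 : N.energyTerm (u : G → ℝ) u = 0 :=
    (hasSum_zero_iff_of_nonneg (N.energyTerm_self_nonneg _)).1 (h0 ▸ u.2.hasSum)
  have h2 : ∀ x y, 0 < N.c x y → (u : G → ℝ) x = (u : G → ℝ) y := by
    intro x y hxy
    have := congrFun h1 (x, y)
    simp only [energyTerm, Pi.zero_apply, mul_eq_zero, hxy.ne', false_or, or_self] at this
    linarith
  have h3 : ∀ x y, (u : G → ℝ) x = (u : G → ℝ) y := by
    intro x y
    induction N.connected x y with
    | refl => rfl
    | tail _ hbc ih => exact ih.trans (h2 _ _ hbc)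
  rw [mem_constants]
  rcases isEmpty_or_nonempty G with h | ⟨⟨o⟩⟩
  · exact ⟨0, fun x => h.elim x⟩
  · exact ⟨(u : G → ℝ) o, fun x => h3 x o⟩

/-- The energy form on `H_𝓔`. -/
def innerForm : N.EnergySpace →ₗ[ℝ] N.EnergySpace →ₗ[ℝ] ℝ :=
  N.constants.liftQ
    (LinearMap.flip (N.constants.liftQ N.energyForm fun u hu => by
      ext v; exact N.energyForm_const hu v))
    fun u hu => by
      refine LinearMap.ext fun w => ?_
      obtain ⟨v, rfl⟩ := N.constants.mkQ_surjective w
      change N.energyForm v u = 0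
      rw [energyForm_symm, N.energyForm_const hu]

lemma innerForm_mk (u v : N.domEnergy) :
    N.innerForm (N.toEnergySpace u) (N.toEnergySpace v) = N.energyForm u v :=
  N.energyForm_symm v u

/-- The inner product `⟨u, v⟩_𝓔 = 𝓔(u, v)` on `H_𝓔`. -/
@[reducible] def innerCore : InnerProductSpace.Core ℝ N.EnergySpace where
  inner u v := N.innerForm u v
  conj_inner_symm u v := by
    obtain ⟨u, rfl⟩ := N.toEnergySpace_surjective u
    obtain ⟨v, rfl⟩ := N.toEnergySpace_surjective v
    simp only [innerForm_mk, conj_trivial]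
    exact N.energyForm_symm v u
  re_inner_nonneg u := by
    obtain ⟨u, rfl⟩ := N.toEnergySpace_surjective u
    rw [innerForm_mk]
    exact N.energyForm_nonneg u
  add_left u v w := by simp
  smul_left u v a := by simp
  definite u hu := by
    obtain ⟨u, rfl⟩ := N.toEnergySpace_surjective u
    rw [innerForm_mk] at hu
    exact (Submodule.Quotient.mk_eq_zero _).2 (N.mem_constants_of_energyForm_eq_zero hu)

instance : NormedAddCommGroup N.EnergySpace :=
  @InnerProductSpace.Core.toNormedAddCommGroup ℝ N.EnergySpace _ _ _ N.innerCore

instance : InnerProductSpace ℝ N.EnergySpace :=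
  InnerProductSpace.ofCore N.innerCore.toCore

lemma inner_mk (u v : N.domEnergy) :
    inner ℝ (N.toEnergySpace u) (N.toEnergySpace v) = N.energy u v :=
  N.innerForm_mk u v

/-- The Laplacian of an element of `H_𝓔`, as a function on `G`; it does not depend on the
representative. -/
def lapE : N.EnergySpace →ₗ[ℝ] (G → ℝ) :=
  N.constants.liftQ (N.lap ∘ₗ N.domEnergy.subtype) fun u hu => by
    obtain ⟨k, hk⟩ := N.mem_constants.1 hu
    rw [LinearMap.mem_ker]
    ext x
    simp [lap, hk]

lemma hasSum_energyTerm_dirac (x : G) (u : G → ℝ) :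
    HasSum (N.energyTerm (dirac x) u) (2 * N.lap u x) := by
  classical
  have h1 : HasSum (fun p : G × G => N.c p.1 p.2 * dirac x p.1 * (u p.1 - u p.2))
      (N.lap u x) := by
    have hinj : Function.Injective (fun y : G => (x, y)) := fun a b h => (Prod.ext_iff.1 h).2
    rw [← hinj.hasSum_iff]
    · have : (fun p : G × G => N.c p.1 p.2 * dirac x p.1 * (u p.1 - u p.2)) ∘ (fun y => (x, y))
          = fun y => N.c x y * (u x - u y) := by
        ext y; simp [dirac]
      rw [this]
      refine hasSum_sum_of_ne_finset_zero fun y hy => ?_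
      have : N.c x y = 0 := by
        by_contra h
        exact hy ((N.locallyFinite x).mem_toFinset.2 (lt_of_le_of_ne (N.c_nonneg x y) (Ne.symm h)))
      simp [this]
    · rintro ⟨a, b⟩ hab
      have : a ≠ x := by rintro rfl; exact hab ⟨b, rfl⟩
      simp [dirac, this]
  have h2 := (Equiv.prodComm G G).hasSum_iff.2 h1
  have h3 := h1.add h2
  rw [← two_mul] at h3
  convert h3 using 1
  ext ⟨a, b⟩
  simp only [energyTerm, Function.comp, Equiv.prodComm_apply, Prod.swap, N.c_symm b a]
  ring

/-- The point masses have finite energy. -/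
lemma dirac_mem_domEnergy (x : G) : dirac x ∈ N.domEnergy :=
  (N.hasSum_energyTerm_dirac x _).summable

/-- The point mass at `x`, as an element of `H_𝓔`. -/
def diracE (x : G) : N.EnergySpace := N.toEnergySpace ⟨dirac x, N.dirac_mem_domEnergy x⟩

lemma inner_diracE (x : G) (u : N.EnergySpace) : inner ℝ (N.diracE x) u = N.lapE u x := by
  obtain ⟨u, rfl⟩ := N.toEnergySpace_surjective u
  rw [diracE, inner_mk, energy, (N.hasSum_energyTerm_dirac x _).tsum_eq]
  change _ = N.lap u x
  ring

/-- `v` is the element `v_x` of the energy kernel with base point `o`: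
`⟨v_x, u⟩ = u(x) - u(o)` for all `u`. -/
def IsEnergyKernel (o x : G) (v : N.EnergySpace) : Prop :=
  ∀ u : N.domEnergy, inner ℝ v (N.toEnergySpace u) = (u : G → ℝ) x - (u : G → ℝ) o

/-- `w` is a monopole at `x`: a solution of finite energy of `Δw = δ_x`, pointwise. -/
def IsMonopole (x : G) (w : N.EnergySpace) : Prop := N.lapE w = dirac x

/-- `w` is the monopole at `x` of minimal energy. -/
def IsMinimalMonopole (x : G) (w : N.EnergySpace) : Prop :=
  N.IsMonopole x w ∧ ∀ w', N.IsMonopole x w' → ‖w‖ ≤ ‖w'‖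

/-- The linear span of the energy kernel `{v_x}` and of the energy-minimizing monopole `w_o`, if
there is one. If it exists, this is the span of the monopoles `w_x = w_o + v_x`, `x ∈ G`
(note that `v_o = 0`); if there is no monopole, it is the span of the energy kernel. -/
def kernelSpan (o : G) : Submodule ℝ N.EnergySpace :=
  Submodule.span ℝ ({v | ∃ x, N.IsEnergyKernel o x v} ∪ {w | N.IsMinimalMonopole o w})

/-- The Laplacian, pointwise, on the elements `u` of `H_𝓔` for which `Δu` has finite energy. -/
def maxLapE : N.EnergySpace →ₗ.[ℝ] N.EnergySpace where
  domain := N.domEnergy.comap N.lapE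
  toFun := N.toEnergySpace ∘ₗ
    (N.lapE ∘ₗ (N.domEnergy.comap N.lapE).subtype).codRestrict N.domEnergy fun u => u.2

/-- The closed operator `Δ_{H_𝓔}`: the closure of the pointwise Laplacian on `kernelSpan`. -/
def laplacianE (o : G) : N.EnergySpace →ₗ.[ℝ] N.EnergySpace :=
  (N.maxLapE.domRestrict (N.kernelSpan o)).closure

/-- The Hilbert space `ℓ²(G)`. -/
abbrev ellTwo (G : Type*) : Type _ := lp (fun _ : G => ℝ) 2

/-- The linear span of the point masses in `ℓ²(G)`. -/
def diracSpan (G : Type*) : Submodule ℝ (ellTwo G) :=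
  Submodule.span ℝ {f | ∃ x : G, (f : G → ℝ) = dirac x}

/-- The elements of `ℓ²(G)` as functions. -/
def ellTwoFun (G : Type*) : ellTwo G →ₗ[ℝ] (G → ℝ) where
  toFun f := f
  map_add' _ _ := rfl
  map_smul' _ _ := rfl

/-- The square-summable functions. -/
def sqSummable (G : Type*) : Submodule ℝ (G → ℝ) where
  carrier := {f | Memℓp f 2}
  zero_mem' := zero_memℓp
  add_mem' hf hg := Memℓp.add hf hg
  smul_mem' a _ hf := Memℓp.const_smul hf a

/-- A square-summable function, as an element of `ℓ²(G)`. -/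
def toEllTwo (G : Type*) : sqSummable G →ₗ[ℝ] ellTwo G where
  toFun f := ⟨(f : G → ℝ), f.2⟩
  map_add' _ _ := rfl
  map_smul' _ _ := rfl

/-- The Laplacian, pointwise, on the `u ∈ ℓ²(G)` for which `Δu` is square-summable. -/
def maxLap2 : ellTwo G →ₗ.[ℝ] ellTwo G where
  domain := (sqSummable G).comap (N.lap ∘ₗ ellTwoFun G)
  toFun := toEllTwo G ∘ₗ
    ((N.lap ∘ₗ ellTwoFun G) ∘ₗ ((sqSummable G).comap (N.lap ∘ₗ ellTwoFun G)).subtype).codRestrict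
      (sqSummable G) fun u => u.2

/-- The closed operator `Δ_{ℓ²}`: the closure of the pointwise Laplacian on `span {δ_x}`. -/
def laplacian2 : ellTwo G →ₗ.[ℝ] ellTwo G :=
  (N.maxLap2.domRestrict (diracSpan G)).closure

/-- The map sending `u ∈ ℓ²(G)` of finite energy to its class in `H_𝓔`. -/
def maxInclusion : ellTwo G →ₗ.[ℝ] N.EnergySpace where
  domain := N.domEnergy.comap (ellTwoFun G)
  toFun := N.toEnergySpace ∘ₗ
    (ellTwoFun G ∘ₗ (N.domEnergy.comap (ellTwoFun G)).subtype).codRestrict N.domEnergy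
      fun u => u.2

/-- The inclusion operator `J`: the closure of `span {δ_x} ⊆ ℓ²(G) → H_𝓔`, `δ_x ↦ δ_x`. -/
def inclusionJ : ellTwo G →ₗ.[ℝ] N.EnergySpace :=
  (N.maxInclusion.domRestrict (diracSpan G)).closure

lemma lapE_energyKernel {o x : G} {v : N.EnergySpace} (hv : N.IsEnergyKernel o x v) :
    N.lapE v = dirac x - dirac o := by
  classical
  ext y
  rw [← inner_diracE, real_inner_comm, diracE, hv]
  simp [dirac, Pi.single_apply, eq_comm]

/-- The operators before closure are defined on all of the respective spans. -/
lemma kernelSpan_le (o : G) : N.kernelSpan o ≤ N.maxLapE.domain := by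
  refine Submodule.span_le.2 ?_
  rintro v (⟨x, hv⟩ | hv)
  · change N.lapE v ∈ N.domEnergy
    rw [N.lapE_energyKernel hv]
    exact sub_mem (N.dirac_mem_domEnergy x) (N.dirac_mem_domEnergy o)
  · change N.lapE v ∈ N.domEnergy
    rw [hv.1]
    exact N.dirac_mem_domEnergy o

lemma diracSpan_le_maxInclusion : diracSpan G ≤ N.maxInclusion.domain := by
  refine Submodule.span_le.2 ?_
  rintro f ⟨x, hf⟩
  change (f : G → ℝ) ∈ N.domEnergy
  rw [hf]
  exact N.dirac_mem_domEnergy x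

lemma diracSpan_le_maxLap2 : diracSpan G ≤ N.maxLap2.domain := by
  classical
  refine Submodule.span_le.2 ?_
  rintro f ⟨x, hf⟩
  change Memℓp (N.lap f) 2
  rw [hf]
  refine (memℓp_zero (Set.Finite.subset ((N.nbrs x ∪ {x}).finite_toSet) ?_)).of_exponent_ge
    (zero_le)
  intro y hy
  by_contra h
  simp only [Finset.coe_union, Finset.coe_singleton, Set.mem_union, Finset.mem_coe,
    Set.mem_singleton_iff, not_or] at h
  refine hy (Finset.sum_eq_zero fun z hz => ?_)
  have hzx : z ≠ x := by
    rintro rfl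
    refine h.1 ((N.locallyFinite z).mem_toFinset.2 ?_)
    rw [Set.mem_ofPred_eq, N.c_symm]
    exact (N.locallyFinite y).mem_toFinset.1 hz
  simp [dirac, h.2, hzx]

end ResistanceNetwork

end

/-! The theorem is the identity `‖T*T‖ = ‖TT*‖ = ‖T‖²` for `T = J`. The duality `⟨Jf, u⟩_𝓔 = ⟨f,
Δu⟩_{ℓ²}` (`inner_inclSpan`) says that the adjoint of `J` acts as the pointwise Laplacian, so
`Δ_{ℓ²}` acts as `J*J` on the point masses and `Δ_{H_𝓔}` as `JJ*` on the kernel span.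

Adjoints of unbounded operators are avoided by comparing constants on the initial domains, which is
harmless since a closure has the same bounds (`LinearPMap.bound_closure_iff`). For `C ≥ 0`,
Cauchy–Schwarz shows that `C` bounds `Δ_{ℓ²}` iff `√C` bounds `J` (`lapSpan_bound_iff`), and
likewise for `Δ_{H_𝓔}` (`lapE_bound_iff`). The latter needs the kernel span to be dense; this rests
on the existence of the `v_x`, hence on the Riesz theorem and on completeness of `H_𝓔`. -/

/-! ### Bounds of partially defined operators and their closures. -/

/-- A bound on the domain of an operator is the same as a bound on the domain of its closure. -/
theorem LinearPMap.bound_closure_iff {E F : Type*} [NormedAddCommGroup E] [NormedSpace ℝ E]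
    [NormedAddCommGroup F] [NormedSpace ℝ F] (T : E →ₗ.[ℝ] F) (C : ℝ) :
    (∀ x : T.closure.domain, ‖T.closure x‖ ≤ C * ‖(x : E)‖) ↔
      ∀ x : T.domain, ‖T x‖ ≤ C * ‖(x : E)‖ := by
  constructor
  · intro h x
    have hle := T.le_closure
    have := h ⟨x, hle.1 x.2⟩
    rwa [← hle.2 (x := x) (y := ⟨x, hle.1 x.2⟩) rfl] at this
  · intro h x
    by_cases hT : T.IsClosable
    · have hx : ((x : E), T.closure x) ∈ T.closure.graph := T.closure.mem_graph x
      rw [← hT.graph_closure_eq_closure_graph] at hx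
      have hcl : _root_.IsClosed {p : E × F | ‖p.2‖ ≤ C * ‖p.1‖} :=
        isClosed_le (by fun_prop) (by fun_prop)
      refine closure_minimal (s := (T.graph : Set (E × F))) ?_ hcl hx
      rintro ⟨a, b⟩ hab
      obtain ⟨y, rfl, rfl⟩ := T.mem_graph_iff.1 hab
      exact h y
    -- For a non-closable operator `closure` defaults to the operator itself, so closability of the
    -- three operators need not be proved.
    · have hc := T.closure_def' hT
      revert x
      rw [hc]
      exact h

/-- The operator norm of a bounded operator is its least nonnegative bound. -/
theorem LinearPMap.IsBoundedOp.isLeast_operatorNorm {E F : Type*} [NormedAddCommGroup E]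
    [NormedSpace ℝ E] [NormedAddCommGroup F] [NormedSpace ℝ F] {T : E →ₗ.[ℝ] F}
    (hT : T.IsBoundedOp) :
    IsLeast {C : ℝ | 0 ≤ C ∧ ∀ x : T.domain, ‖T x‖ ≤ C * ‖(x : E)‖} T.operatorNorm := by
  obtain ⟨C, hC⟩ := hT
  have hb : BddBelow {C : ℝ | 0 ≤ C ∧ ∀ x : T.domain, ‖T x‖ ≤ C * ‖(x : E)‖} :=
    ⟨0, fun _ h => h.1⟩
  -- The bounds form a closed set, so the infimum is attained. The given `C` may be negative when
  -- the domain is trivial, hence `max C 0`.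
  refine ⟨IsClosed.csInf_mem ?_ ⟨max C 0, le_max_right _ _, fun x => (hC x).trans ?_⟩ hb,
    fun C hC => csInf_le hb hC⟩
  · simp only [Set.ofPred_and, Set.ofPred_forall]
    exact (isClosed_le continuous_const continuous_id).inter
      (isClosed_iInter fun x => isClosed_le continuous_const (by fun_prop))
  · exact mul_le_mul_of_nonneg_right (le_max_left _ _) (norm_nonneg _)

theorem LinearPMap.isBoundedOp_iff_exists_nonneg {E F : Type*} [NormedAddCommGroup E]
    [NormedSpace ℝ E] [NormedAddCommGroup F] [NormedSpace ℝ F] {T : E →ₗ.[ℝ] F} :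
    T.IsBoundedOp ↔ ∃ C : ℝ, 0 ≤ C ∧ ∀ x : T.domain, ‖T x‖ ≤ C * ‖(x : E)‖ :=
  ⟨fun h => ⟨_, h.isLeast_operatorNorm.1⟩, fun ⟨C, _, h⟩ => ⟨C, h⟩⟩

namespace ResistanceNetwork

variable {G : Type*} (N : ResistanceNetwork G)

noncomputable section

/-! ### The gradient embedding and completeness of the energy space. -/

/-- The weighted gradient `u ↦ √(c_{xy}/2) (u(x) - u(y))`. -/
def gradFun : (G → ℝ) →ₗ[ℝ] (G × G → ℝ) where
  toFun u p := √(N.c p.1 p.2 / 2) * (u p.1 - u p.2)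
  map_add' u v := by ext p; simp only [Pi.add_apply]; ring
  map_smul' a u := by
    ext p; simp only [Pi.smul_apply, smul_eq_mul, RingHom.id_apply]; ring

theorem gradFun_apply (u : G → ℝ) (p : G × G) :
    N.gradFun u p = √(N.c p.1 p.2 / 2) * (u p.1 - u p.2) := rfl

theorem gradFun_sq (u : G → ℝ) (p : G × G) :
    N.gradFun u p ^ 2 = 1 / 2 * N.energyTerm u u p := by
  rw [gradFun_apply, mul_pow, Real.sq_sqrt (div_nonneg (N.c_nonneg _ _) two_pos.le), energyTerm]
  ring

theorem memℓp_two_iff {ι : Type*} {f : ι → ℝ} : Memℓp f 2 ↔ Summable fun i => f i ^ 2 := by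
  rw [memℓp_gen_iff (by norm_num)]
  simp

theorem memℓp_gradFun_iff {u : G → ℝ} : Memℓp (N.gradFun u) 2 ↔ u ∈ N.domEnergy := by
  rw [memℓp_two_iff]
  simp only [gradFun_sq]
  exact summable_mul_left_iff (by norm_num)

/-- The weighted gradient, from functions of finite energy to `ℓ²(G × G)`. -/
def gradDom : N.domEnergy →ₗ[ℝ] ellTwo (G × G) :=
  toEllTwo (G × G) ∘ₗ (N.gradFun ∘ₗ N.domEnergy.subtype).codRestrict (sqSummable (G × G))
    fun u => N.memℓp_gradFun_iff.2 u.2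

theorem gradDom_apply (u : N.domEnergy) (p : G × G) : N.gradDom u p = N.gradFun u p := rfl

theorem norm_gradDom (u : N.domEnergy) : ‖N.gradDom u‖ = ‖N.toEnergySpace u‖ := by
  refine (sq_eq_sq₀ (norm_nonneg _) (norm_nonneg _)).1 ?_
  rw [← real_inner_self_eq_norm_sq, ← real_inner_self_eq_norm_sq, inner_mk, lp.inner_eq_tsum,
    energy, ← tsum_mul_left]
  refine tsum_congr fun p => ?_
  rw [← gradFun_sq, gradDom_apply]
  simp [sq]

/-- The isometric embedding of `H_𝓔` into `ℓ²(G × G)` by the weighted gradient. -/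
def grad : N.EnergySpace →ₗᵢ[ℝ] ellTwo (G × G) where
  toLinearMap := N.constants.liftQ N.gradDom fun u hu => by
    rw [LinearMap.mem_ker, ← norm_eq_zero, norm_gradDom, norm_eq_zero]
    exact (Submodule.Quotient.mk_eq_zero _).2 hu
  norm_map' u := by
    obtain ⟨u, rfl⟩ := N.toEnergySpace_surjective u
    exact N.norm_gradDom u

theorem grad_mk (u : N.domEnergy) : N.grad (N.toEnergySpace u) = N.gradDom u := rfl

/-- The difference of the values at two vertices is bounded by the energy norm. -/
theorem exists_abs_sub_le (x y : G) :
    ∃ C : ℝ, ∀ u : N.domEnergy, |(u : G → ℝ) y - (u : G → ℝ) x| ≤ C * ‖N.toEnergySpace u‖ := by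
  induction N.connected x y with
  | refl => exact ⟨0, fun u => by simp⟩
  | @tail a b _ hab ih =>
    obtain ⟨C, hC⟩ := ih
    -- A single coordinate of the gradient, at the edge `(a, b)`, is at most its norm; the resulting
    -- constants add up along a path.
    refine ⟨C + (√(N.c a b / 2))⁻¹, fun u => ?_⟩
    have hs : 0 < √(N.c a b / 2) := Real.sqrt_pos.2 (by positivity)
    have h1 : |N.gradDom u (a, b)| ≤ ‖N.toEnergySpace u‖ := by
      rw [← norm_gradDom]
      exact lp.norm_apply_le_norm (by norm_num) (N.gradDom u) (a, b)
    rw [gradDom_apply, gradFun_apply, abs_mul, abs_of_pos hs] at h1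
    have h2 : |(u : G → ℝ) b - (u : G → ℝ) a| ≤ (√(N.c a b / 2))⁻¹ * ‖N.toEnergySpace u‖ := by
      rw [abs_sub_comm, inv_mul_eq_div, le_div_iff₀ hs, mul_comm]
      exact h1
    calc _ ≤ |(u : G → ℝ) b - (u : G → ℝ) a| + |(u : G → ℝ) a - (u : G → ℝ) x| :=
          abs_sub_le _ _ _
      _ ≤ _ := by rw [add_mul]; linarith [hC u]

/-- The evaluation functional `u ↦ u(x) - u(o)` on `H_𝓔`. -/
def evalSub (o x : G) : N.EnergySpace →L[ℝ] ℝ :=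
  LinearMap.mkContinuousOfExistsBound
    (N.constants.liftQ ((LinearMap.proj (R := ℝ) (φ := fun _ : G => ℝ) x - LinearMap.proj o) ∘ₗ
        N.domEnergy.subtype)
      fun u hu => by
        obtain ⟨k, hk⟩ := N.mem_constants.1 hu
        simp [hk]) <| by
    obtain ⟨C, hC⟩ := N.exists_abs_sub_le o x
    refine ⟨C, fun u => ?_⟩
    obtain ⟨u, rfl⟩ := N.toEnergySpace_surjective u
    exact hC u

theorem evalSub_mk (o x : G) (u : N.domEnergy) :
    N.evalSub o x (N.toEnergySpace u) = (u : G → ℝ) x - (u : G → ℝ) o := rfl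

-- If gradients converge in `ℓ²(G × G)`, the potentials normalized to vanish at `o` converge
-- pointwise, because evaluations are continuous in energy. The gradient of the limit potential is
-- the limit gradient, and its square-summability gives finite energy.
open Filter Topology in
theorem isClosed_range_grad : IsClosed (Set.range N.grad) := by
  rcases isEmpty_or_nonempty G with h | ⟨⟨o⟩⟩
  · have : Subsingleton (ellTwo (G × G)) :=
      ⟨fun f g => lp.ext (funext fun p => (h.elim p.1 : _))⟩
    exact Set.subsingleton_of_subsingleton.isClosed
  refine isClosed_of_closure_subset fun F hF => ?_
  obtain ⟨s, hs, hsF⟩ := mem_closure_iff_seq_limit.1 hF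
  choose w hw using hs
  have hcau : CauchySeq w := by
    have h := hsF.cauchySeq
    rw [← funext hw] at h
    exact N.grad.isometry.isUniformInducing.cauchy_map_iff.1 h
  choose u hu using fun x => cauchySeq_tendsto_of_complete
    ((N.evalSub o x).uniformContinuous.comp_cauchySeq hcau)
  have hgrad : N.gradFun u = F := by
    ext p
    have h1 : Tendsto (fun n => s n p) atTop (𝓝 (F p)) := by
      have := (lp.uniformContinuous_coe (E := fun _ : G × G => ℝ) (p := 2)).continuous.tendsto F
      exact (tendsto_pi_nhds.1 (this.comp hsF)) p
    have h2 : Tendsto (fun n => s n p) atTop (𝓝 (N.gradFun u p)) := by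
      have : (fun n => s n p) = fun n =>
          √(N.c p.1 p.2 / 2) * (N.evalSub o p.1 (w n) - N.evalSub o p.2 (w n)) := by
        ext n
        rw [← hw]
        obtain ⟨v, hv⟩ := N.toEnergySpace_surjective (w n)
        rw [← hv, grad_mk, gradDom_apply, gradFun_apply, evalSub_mk, evalSub_mk]
        ring
      rw [this]
      exact ((hu p.1).sub (hu p.2)).const_mul _
    exact tendsto_nhds_unique h2 h1
  have hmem : u ∈ N.domEnergy := by
    rw [← memℓp_gradFun_iff, hgrad]
    exact lp.memℓp F
  exact ⟨N.toEnergySpace ⟨u, hmem⟩, lp.ext hgrad⟩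

instance : CompleteSpace N.EnergySpace := by
  rw [completeSpace_iff_isComplete_range N.grad.isometry.isUniformInducing]
  exact N.isClosed_range_grad.isComplete

/-! ### The energy kernel: existence and density. -/

/-- The energy kernel exists. -/
theorem exists_isEnergyKernel (o x : G) : ∃ v, N.IsEnergyKernel o x v :=
  ⟨(InnerProductSpace.toDual ℝ N.EnergySpace).symm (N.evalSub o x), fun u => by
    rw [InnerProductSpace.toDual_symm_apply, evalSub_mk]⟩

/-- The energy kernel spans a dense subspace. -/
theorem dense_kernelSpan (o : G) : Dense (N.kernelSpan o : Set N.EnergySpace) := by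
  rw [Submodule.dense_iff_topologicalClosure_eq_top, Submodule.topologicalClosure_eq_top_iff,
    Submodule.eq_bot_iff]
  intro u hu
  obtain ⟨u, rfl⟩ := N.toEnergySpace_surjective u
  refine (Submodule.Quotient.mk_eq_zero _).2 (N.mem_constants.2 ⟨(u : G → ℝ) o, fun x => ?_⟩)
  -- Orthogonality to the `v_x` alone already forces `u(x) = u(o)`; the monopole plays no role in
  -- density.
  obtain ⟨v, hv⟩ := N.exists_isEnergyKernel o x
  have h := (Submodule.mem_orthogonal _ _).1 hu v (Submodule.subset_span (Or.inl ⟨x, hv⟩))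
  rw [hv u] at h
  exact sub_eq_zero.1 h

/-! ### Finitely supported functions and their Laplacians. -/

/-- Finitely supported functions belong to the span of the point masses. -/
theorem mem_diracSpan_of_finite_support {f : ellTwo G} (hf : (f : G → ℝ).support.Finite) :
    f ∈ diracSpan G := by
  classical
  have h : f = ∑ x ∈ hf.toFinset, (f x) • lp.single 2 x (1 : ℝ) := by
    refine lp.ext (funext fun y => ?_)
    rw [lp.coeFn_sum, Finset.sum_apply]
    simp only [lp.coeFn_smul, Pi.smul_apply, lp.coeFn_single, Pi.single_apply, smul_eq_mul,
      mul_ite, mul_one, mul_zero, Finset.sum_ite_eq, Set.Finite.mem_toFinset,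
      Function.mem_support]
    split_ifs with hy
    · rfl
    · exact not_not.1 hy
  rw [h]
  refine Submodule.sum_mem _ fun x _ => Submodule.smul_mem _ _ (Submodule.subset_span ⟨x, ?_⟩)
  rw [lp.coeFn_single, dirac]

theorem finite_support_of_mem_diracSpan {f : ellTwo G} (hf : f ∈ diracSpan G) :
    (f : G → ℝ).support.Finite := by
  classical
  induction hf using Submodule.span_induction with
  | mem f hf =>
    obtain ⟨x, hx⟩ := hf
    rw [hx]
    refine (Set.finite_singleton x).subset fun y hy => ?_
    by_contra h
    exact hy (by simp [dirac, show y ≠ x from h])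
  | zero => exact (Set.finite_empty).subset fun y hy => (hy rfl).elim
  | add f g _ _ hf hg => exact (hf.union hg).subset (Function.support_add _ _)
  | smul a f _ hf => exact hf.subset (Function.support_const_smul_subset a _)

theorem finite_support_lap {u : G → ℝ} (hu : u.support.Finite) : (N.lap u).support.Finite := by
  refine (hu.union (hu.biUnion fun x _ => (N.nbrs x).finite_toSet)).subset fun y hy => ?_
  by_contra h
  simp only [Set.mem_union, Function.mem_support, not_or, not_not, Set.mem_iUnion, not_exists,
    Finset.mem_coe] at h
  refine hy (Finset.sum_eq_zero fun z hz => ?_)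
  have hzu : u z = 0 := by
    by_contra hz0
    refine h.2 z hz0 ((N.locallyFinite z).mem_toFinset.2 ?_)
    rw [Set.mem_ofPred_eq, N.c_symm]
    exact (N.locallyFinite y).mem_toFinset.1 hz
  simp [h.1, hzu]

/-- The inclusion `J` on the span of the point masses. -/
def inclSpan : diracSpan G →ₗ[ℝ] N.EnergySpace :=
  N.maxInclusion.toFun ∘ₗ Submodule.inclusion N.diracSpan_le_maxInclusion

/-- The Laplacian on the span of the point masses. -/
def lapSpan : diracSpan G →ₗ[ℝ] ellTwo G :=
  N.maxLap2.toFun ∘ₗ Submodule.inclusion N.diracSpan_le_maxLap2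

/-- This feeds `u = Jf` into the duality, which is how `Δ_{ℓ²} = J*J` is used. -/
theorem coe_lapSpan (f : diracSpan G) :
    ((N.lapSpan f : ellTwo G) : G → ℝ) = N.lapE (N.inclSpan f) := rfl

/-- Local finiteness makes `Δf` finitely supported, so that `J` can be applied to it again. -/
theorem lapSpan_mem (f : diracSpan G) : N.lapSpan f ∈ diracSpan G :=
  mem_diracSpan_of_finite_support
    (N.finite_support_lap (finite_support_of_mem_diracSpan f.2))

/-- The Laplacian maps the span of the energy kernel to the span of the point masses. -/
theorem exists_lapE_eq {o : G} {z : N.EnergySpace} (hz : z ∈ N.kernelSpan o) :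
    ∃ g : diracSpan G, ((g : ellTwo G) : G → ℝ) = N.lapE z := by
  classical
  have hd (x : G) : ∃ g : diracSpan G, ((g : ellTwo G) : G → ℝ) = dirac x := by
    have h : ((lp.single 2 x (1 : ℝ) : ellTwo G) : G → ℝ) = dirac x := by
      rw [lp.coeFn_single, dirac]
    exact ⟨⟨lp.single 2 x 1, Submodule.subset_span ⟨x, h⟩⟩, h⟩
  induction hz using Submodule.span_induction with
  | mem z hz =>
    rcases hz with ⟨x, hz⟩ | hz
    · obtain ⟨g, hg⟩ := hd x
      obtain ⟨g', hg'⟩ := hd o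
      refine ⟨g - g', ?_⟩
      rw [N.lapE_energyKernel hz, ← hg, ← hg']
      rfl
    · obtain ⟨g, hg⟩ := hd o
      exact ⟨g, hg.trans hz.1.symm⟩
  | zero => exact ⟨0, by rw [map_zero]; rfl⟩
  | add z z' _ _ hz hz' =>
    obtain ⟨g, hg⟩ := hz
    obtain ⟨g', hg'⟩ := hz'
    exact ⟨g + g', by rw [map_add, ← hg, ← hg']; rfl⟩
  | smul a z _ hz =>
    obtain ⟨g, hg⟩ := hz
    exact ⟨a • g, by rw [map_smul, ← hg]; rfl⟩

/-! ### Duality, and reduction of the bounds to the initial domains. -/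

/-- The duality `⟨Jf, u⟩_𝓔 = ⟨f, Δu⟩_{ℓ²}` between the inclusion and the Laplacian. -/
theorem inner_inclSpan (f : diracSpan G) {u : N.EnergySpace} {g : ellTwo G}
    (hg : (g : G → ℝ) = N.lapE u) : inner ℝ (N.inclSpan f) u = inner ℝ (f : ellTwo G) g := by
  classical
  obtain ⟨f, hf⟩ := f
  induction hf using Submodule.span_induction with
  | mem f hf =>
    obtain ⟨x, hx⟩ := hf
    have h1 : f = lp.single 2 x (1 : ℝ) := by
      refine lp.ext ?_
      rw [hx, lp.coeFn_single, dirac]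
    have h2 : N.inclSpan ⟨f, Submodule.subset_span ⟨x, hx⟩⟩ = N.diracE x :=
      congrArg N.toEnergySpace (Subtype.ext hx)
    -- For a point mass both sides equal `(Δu)(x)`.
    rw [h2, inner_diracE, ← hg]
    change _ = inner ℝ f g
    rw [h1, lp.inner_single_left]
    simp
  | zero =>
    have : N.inclSpan ⟨0, Submodule.zero_mem _⟩ = 0 := map_zero _
    rw [this, inner_zero_left, inner_zero_left]
  | add f f' hf hf' h h' =>
    have : N.inclSpan ⟨f + f', Submodule.add_mem _ hf hf'⟩ =
        N.inclSpan ⟨f, hf⟩ + N.inclSpan ⟨f', hf'⟩ := map_add N.inclSpan ⟨f, hf⟩ ⟨f', hf'⟩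
    rw [this, inner_add_left, h, h', ← inner_add_left]
  | smul a f hf h =>
    have : N.inclSpan ⟨a • f, Submodule.smul_mem _ a hf⟩ = a • N.inclSpan ⟨f, hf⟩ :=
      map_smul N.inclSpan a ⟨f, hf⟩
    rw [this, real_inner_smul_left, h, ← real_inner_smul_left]

theorem bound_inclusionJ_iff (C : ℝ) :
    (∀ x : N.inclusionJ.domain, ‖N.inclusionJ x‖ ≤ C * ‖(x : ellTwo G)‖) ↔
      ∀ f : diracSpan G, ‖N.inclSpan f‖ ≤ C * ‖f‖ := by
  refine (LinearPMap.bound_closure_iff _ C).trans ⟨fun h f => ?_, fun h f => ?_⟩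
  · exact h ⟨f, f.2, N.diracSpan_le_maxInclusion f.2⟩
  · exact h ⟨f, f.2.1⟩

theorem bound_laplacian2_iff (C : ℝ) :
    (∀ x : N.laplacian2.domain, ‖N.laplacian2 x‖ ≤ C * ‖(x : ellTwo G)‖) ↔
      ∀ f : diracSpan G, ‖N.lapSpan f‖ ≤ C * ‖f‖ := by
  refine (LinearPMap.bound_closure_iff _ C).trans ⟨fun h f => ?_, fun h f => ?_⟩
  · exact h ⟨f, f.2, N.diracSpan_le_maxLap2 f.2⟩
  · exact h ⟨f, f.2.1⟩

/-- This is the factorization `JJ*`: `Δz` is finitely supported, and its class in `H_𝓔` is `Jg` for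
the same function `g` viewed in `ℓ²(G)`. -/
theorem bound_laplacianE_iff (o : G) (C : ℝ) :
    (∀ x : (N.laplacianE o).domain, ‖N.laplacianE o x‖ ≤ C * ‖(x : N.EnergySpace)‖) ↔
      ∀ z ∈ N.kernelSpan o, ∀ g : diracSpan G, ((g : ellTwo G) : G → ℝ) = N.lapE z →
        ‖N.inclSpan g‖ ≤ C * ‖z‖ := by
  have key (z : N.EnergySpace) (hz : z ∈ N.kernelSpan o ⊓ N.maxLapE.domain) (g : diracSpan G)
      (hg : ((g : ellTwo G) : G → ℝ) = N.lapE z) :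
      N.maxLapE.domRestrict (N.kernelSpan o) ⟨z, hz⟩ = N.inclSpan g :=
    congrArg N.toEnergySpace (Subtype.ext hg.symm)
  refine (LinearPMap.bound_closure_iff _ C).trans ⟨fun h z hz g hg => ?_, fun h z => ?_⟩
  · rw [← key z ⟨hz, N.kernelSpan_le o hz⟩ g hg]
    exact h ⟨z, hz, N.kernelSpan_le o hz⟩
  · obtain ⟨g, hg⟩ := N.exists_lapE_eq z.2.1
    exact (key z z.2 g hg).symm ▸ h z z.2.1 g hg

/-! ### Comparison of the three bounds. -/

theorem le_of_sq_le_mul {a b : ℝ} (ha : 0 ≤ a) (hb : 0 ≤ b) (h : a ^ 2 ≤ b * a) : a ≤ b := by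
  rcases ha.eq_or_lt with rfl | ha
  · exact hb
  · exact le_of_mul_le_mul_right (by rwa [← sq]) ha

/-- One direction is `‖Jf‖² = ⟨f, Δf⟩ ≤ C‖f‖²`. For the other, `‖Δf‖² = ⟨JΔf, Jf⟩ ≤ C‖Δf‖‖f‖`, and a
factor `‖Δf‖` cancels. -/
theorem lapSpan_bound_iff {C : ℝ} (hC : 0 ≤ C) :
    (∀ f : diracSpan G, ‖N.lapSpan f‖ ≤ C * ‖f‖) ↔
      ∀ f : diracSpan G, ‖N.inclSpan f‖ ≤ √C * ‖f‖ := by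
  constructor
  · intro h f
    refine abs_le_of_sq_le_sq' ?_ (by positivity) |>.2
    rw [mul_pow, Real.sq_sqrt hC, ← real_inner_self_eq_norm_sq,
      N.inner_inclSpan f (N.coe_lapSpan f), ← Submodule.norm_coe]
    calc _ ≤ ‖(f : ellTwo G)‖ * ‖N.lapSpan f‖ := real_inner_le_norm (f : ellTwo G) (N.lapSpan f)
      _ ≤ ‖(f : ellTwo G)‖ * (C * ‖(f : ellTwo G)‖) := by gcongr; exact h f
      _ = _ := by ring
  · intro h f
    refine le_of_sq_le_mul (norm_nonneg _) (by positivity) ?_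
    let g : diracSpan G := ⟨N.lapSpan f, N.lapSpan_mem f⟩
    calc ‖N.lapSpan f‖ ^ 2 = inner ℝ (N.inclSpan g) (N.inclSpan f) := by
          rw [N.inner_inclSpan g (N.coe_lapSpan f), ← real_inner_self_eq_norm_sq]
      _ ≤ ‖N.inclSpan g‖ * ‖N.inclSpan f‖ := real_inner_le_norm _ _
      _ ≤ (√C * ‖g‖) * (√C * ‖f‖) := by gcongr <;> exact h _
      _ = (√C * √C) * ‖f‖ * ‖N.lapSpan f‖ := by
          rw [show ‖g‖ = ‖N.lapSpan f‖ from rfl]; ring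
      _ = _ := by rw [Real.mul_self_sqrt hC]

/-- With `g = Δz` in the role of `J*z`, duality gives `‖g‖² = ⟨Jg, z⟩`. A bound on `JJ*` thus bounds
`J*` by `√C`, and a bound on `J` bounds `J*`, hence `JJ*`. -/
theorem lapE_bound_iff (o : G) {C : ℝ} (hC : 0 ≤ C) :
    (∀ z ∈ N.kernelSpan o, ∀ g : diracSpan G, ((g : ellTwo G) : G → ℝ) = N.lapE z →
        ‖N.inclSpan g‖ ≤ C * ‖z‖) ↔
      ∀ f : diracSpan G, ‖N.inclSpan f‖ ≤ √C * ‖f‖ := by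
  have key {z : N.EnergySpace} {g : diracSpan G} (hg : ((g : ellTwo G) : G → ℝ) = N.lapE z) :
      ‖g‖ ^ 2 ≤ ‖N.inclSpan g‖ * ‖z‖ := by
    refine le_trans (le_of_eq ?_) (real_inner_le_norm _ _)
    rw [N.inner_inclSpan g hg, real_inner_self_eq_norm_sq]
    rfl
  constructor
  · intro h f
    -- The bound on `J*` passes to `J` by testing against the dense kernel span; by continuity `z =
    -- Jf` is then allowed, although it need not lie in that span.
    have hz : ∀ z : N.EnergySpace, inner ℝ (N.inclSpan f) z ≤ √C * ‖f‖ * ‖z‖ := by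
      refine fun z => (N.dense_kernelSpan o).induction ?_
        (isClosed_le (by fun_prop) (by fun_prop)) z
      intro z hz
      obtain ⟨g, hg⟩ := N.exists_lapE_eq hz
      have hgz : ‖g‖ ≤ √C * ‖z‖ := by
        refine abs_le_of_sq_le_sq' ?_ (by positivity) |>.2
        rw [mul_pow, Real.sq_sqrt hC]
        calc _ ≤ _ := key hg
          _ ≤ (C * ‖z‖) * ‖z‖ := by gcongr; exact h z hz g hg
          _ = _ := by ring
      rw [N.inner_inclSpan f hg]
      calc _ ≤ ‖f‖ * ‖g‖ := real_inner_le_norm _ _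
        _ ≤ ‖f‖ * (√C * ‖z‖) := by gcongr
        _ = _ := by ring
    refine le_of_sq_le_mul (norm_nonneg _) (by positivity) ?_
    rw [← real_inner_self_eq_norm_sq]
    exact hz _
  · intro h z _ g hg
    have hgz : ‖g‖ ≤ √C * ‖z‖ := by
      refine le_of_sq_le_mul (norm_nonneg _) (by positivity) ((key hg).trans ?_)
      calc _ ≤ (√C * ‖g‖) * ‖z‖ := by gcongr; exact h g
        _ = _ := by ring
    calc _ ≤ √C * ‖g‖ := h g
      _ ≤ √C * (√C * ‖z‖) := by gcongr
      _ = (√C * √C) * ‖z‖ := by ring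
      _ = _ := by rw [Real.mul_self_sqrt hC]

end

end ResistanceNetwork

theorem mainTheorem2 {G : Type*} (N : ResistanceNetwork G) (o : G) :
    List.TFAE [N.laplacian2.IsBoundedOp, (N.laplacianE o).IsBoundedOp, N.inclusionJ.IsBoundedOp] ∧
      (N.laplacian2.IsBoundedOp →
        N.laplacian2.operatorNorm = (N.laplacianE o).operatorNorm ∧
          (N.laplacianE o).operatorNorm = N.inclusionJ.operatorNorm ^ 2) := by
  have h2J {C : ℝ} (hC : 0 ≤ C) :=
    (N.bound_laplacian2_iff C).trans
      ((N.lapSpan_bound_iff hC).trans (N.bound_inclusionJ_iff √C).symm)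
  have hEJ {C : ℝ} (hC : 0 ≤ C) :=
    (N.bound_laplacianE_iff o C).trans
      ((N.lapE_bound_iff o hC).trans (N.bound_inclusionJ_iff √C).symm)
  have hb2E : N.laplacian2.IsBoundedOp ↔ (N.laplacianE o).IsBoundedOp := by
    simp only [LinearPMap.isBoundedOp_iff_exists_nonneg]
    exact exists_congr fun C => and_congr_right fun hC => (h2J hC).trans (hEJ hC).symm
  have hbEJ : (N.laplacianE o).IsBoundedOp ↔ N.inclusionJ.IsBoundedOp := by
    simp only [LinearPMap.isBoundedOp_iff_exists_nonneg]
    constructor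
    · rintro ⟨C, hC, h⟩
      exact ⟨√C, Real.sqrt_nonneg C, (hEJ hC).1 h⟩
    · rintro ⟨C, hC, h⟩
      exact ⟨C ^ 2, sq_nonneg C, (hEJ (sq_nonneg C)).2 (by rwa [Real.sqrt_sq hC])⟩
  refine ⟨?_, fun hb => ?_⟩
  · tfae_have 1 ↔ 2 := hb2E
    tfae_have 2 ↔ 3 := hbEJ
    tfae_finish
  · have hE := hb2E.1 hb
    have lE := hE.isLeast_operatorNorm
    have lJ := (hbEJ.1 hE).isLeast_operatorNorm
    -- Each norm is the least element of its set of bounds, so matching the sets, via `C ↦ √C` for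
    -- `J`, identifies the norms.
    refine ⟨?_, lE.unique ⟨⟨sq_nonneg _, ?_⟩, ?_⟩⟩
    · refine hb.isLeast_operatorNorm.unique ⟨⟨lE.1.1, ?_⟩, fun C hC => lE.2 ⟨hC.1, ?_⟩⟩
      · exact (h2J lE.1.1).2 ((hEJ lE.1.1).1 lE.1.2)
      · exact (hEJ hC.1).2 ((h2J hC.1).1 hC.2)
    · rw [hEJ (sq_nonneg _), Real.sqrt_sq lJ.1.1]
      exact lJ.1.2
    · rintro C ⟨hC, h⟩
      exact (Real.le_sqrt lJ.1.1 hC).1 (lJ.2 ⟨Real.sqrt_nonneg C, (hEJ hC).1 h⟩)
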